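/- Let $n$ be a positive odd integer and let $q$ be a nonzero element of a field $K$ that is not a root of unity (for example, an indeterminate $q$ in $K=\mathbb{Q}(q)$, or a complex number $q$ with $0<|q|<1$). Write $(a;q)_k=\prod_{j=0}^{k-1}(1-aq^j)$ and $[m]=(1-q^m)/(1-q)$, let $\left(\frac{-3}{n}\right)$ denote the Jacobi–Kronecker symbol, and for $k\ge 0$ put $$c_k=\frac{(q^{1-n};q^2)_k\,(q^{1+n};q^2)_k\,(q;q^2)_{2k}}{(q^2;q^2)_{2k}\,(q^{6-n};q^6)_k\,(q^{6+n};q^6)_k}\,[8k+1]\,q^{2k^2}.$$ Then $c_k=0$ for all $k>(n-1)/2$, and $$\sum_{k=0}^{n-1}c_k=q^{-(n-1)/2}\,[n]\left(\frac{-3}{n}\right).$$ -/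

import Mathlib

/-- The `q`-Pochhammer symbol `(a; q)_k = ∏_{j=0}^{k-1} (1 - a q^j)`. -/
def qPochhammer {K : Type*} [Field K] (a q : K) (k : ℕ) : K :=
  ∏ j ∈ Finset.range k, (1 - a * q ^ j)

/-- The `q`-number `[m]_q = (1 - q^m) / (1 - q)` (used only for `q ≠ 1`). -/
def qNumber {K : Type*} [Field K] (q : K) (m : ℕ) : K :=
  (1 - q ^ m) / (1 - q)

/-- The `k`-th summand
`(q^{1-n};q²)_k (q^{1+n};q²)_k (q;q²)_{2k} / ((q²;q²)_{2k} (q^{6-n};q⁶)_k (q^{6+n};q⁶)_k)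
  · [8k+1]_q · q^{2k²}`. -/
def cubicSummand {K : Type*} [Field K] (q : K) (n k : ℕ) : K :=
  (qPochhammer (q ^ (1 - (n : ℤ))) (q ^ 2) k * qPochhammer (q ^ (1 + (n : ℤ))) (q ^ 2) k
      * qPochhammer q (q ^ 2) (2 * k))
    / (qPochhammer (q ^ 2) (q ^ 2) (2 * k) * qPochhammer (q ^ (6 - (n : ℤ))) (q ^ 6) k
      * qPochhammer (q ^ (6 + (n : ℤ))) (q ^ 6) k)
    * qNumber q (8 * k + 1) * q ^ (2 * k ^ 2)

/-! ### Shift rules for `q`-Pochhammer symbols -/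

section qPochhammer

variable {K : Type*} [Field K]

/-! Write `n = 2m + 1`, `p = q²`, `b = p⁻ᵐ`; up to the factor `1 - q`, the summand is `cubicTerm p a
b k` at `a = q`. The proof frees `a`. Telescoping (`cubicTerm_shift_sub`) relates the sums at `a`
and `a p³`. Clearing denominators gives a polynomial `N(a)` with `N(p³a)(1 - a)(1 - p²a) = N(a)(1 -
p^(3+4m) a)(1 - p^(2+2m) a)`. Since `p³` is not a root of unity, comparing coefficients shows that
`N` is determined by `N(0)`.

If `m ≢ 1 (mod 3)`, the product `(a; p³)_s (a p²; p³)_t` solves the equation for suitable `s`, `t`,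
so `N` is `N(0)` times it. The constant `N(0) = cubicConst p m` satisfies a three-step recursion in
`m`, by a second telescoping under `b ↦ b p³` at `a = 0`, with initial values `1, 0, -1/p`. Hence `N
= 0` when `m ≡ 1 (mod 3)`; otherwise, at `a = q`, every factor cancels except `1 - qⁿ`, a power of
`q` and a sign. The values `1, 0, -1` on the classes of `m` mod 3 are those of the Jacobi symbol. -/

theorem qPochhammer_zero (a q : K) : qPochhammer a q 0 = 1 := by
  simp [qPochhammer]

theorem qPochhammer_succ (a q : K) (k : ℕ) :
    qPochhammer a q (k + 1) = qPochhammer a q k * (1 - a * q ^ k) := by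
  simp [qPochhammer, Finset.prod_range_succ]

theorem qPochhammer_add (a q : K) (m k : ℕ) :
    qPochhammer a q (m + k) = qPochhammer a q m * qPochhammer (a * q ^ m) q k := by
  simp only [qPochhammer, Finset.prod_range_add]
  congr 1
  exact Finset.prod_congr rfl fun j _ => by ring

theorem qPochhammer_one (a q : K) : qPochhammer a q 1 = 1 - a := by
  simp [qPochhammer]

/-- Shifting the first parameter by one power of the base. -/
theorem one_sub_mul_qPochhammer (a q : K) (k : ℕ) :
    (1 - a) * qPochhammer (a * q) q k = qPochhammer a q k * (1 - a * q ^ k) := by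
  rw [← qPochhammer_succ, add_comm, qPochhammer_add, qPochhammer_one, pow_one]

theorem qPochhammer_ne_zero {a q : K} {k : ℕ} (h : ∀ j < k, a * q ^ j ≠ 1) :
    qPochhammer a q k ≠ 0 :=
  Finset.prod_ne_zero_iff.2 fun j hj => sub_ne_zero.2 (h j (Finset.mem_range.1 hj)).symm

theorem qPochhammer_eq_zero {a q : K} {k j : ℕ} (hj : j < k) (h : a * q ^ j = 1) :
    qPochhammer a q k = 0 :=
  Finset.prod_eq_zero (Finset.mem_range.2 hj) (by rw [h, sub_self])

/-- Both sides are `(a; q)_{k+3}`, with three factors split off at either end. -/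
theorem one_sub_mul_qPochhammer_three (a q : K) (k : ℕ) :
    (1 - a) * (1 - a * q) * (1 - a * q ^ 2) * qPochhammer (a * q ^ 3) q k =
      qPochhammer a q k *
        ((1 - a * q ^ k) * (1 - a * q ^ (k + 1)) * (1 - a * q ^ (k + 2))) := by
  have h1 := qPochhammer_add a q 3 k
  have h2 := qPochhammer_add a q k 3
  have h3 (c : K) : qPochhammer c q 3 = (1 - c) * (1 - c * q) * (1 - c * q ^ 2) := by
    simp [qPochhammer, Finset.prod_range_succ]
  rw [h3] at h1 h2
  rw [← h1, add_comm, h2]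
  ring

end qPochhammer

/-! ### Telescoping under `a ↦ a p³` -/

section Telescoping

variable {K : Type*} [Field K]

/-- The `k`-th term of the bibasic series with free parameters `a`, `b` and base `p`. -/
def cubicTerm (p a b : K) (k : ℕ) : K :=
  (1 - a * p ^ (4 * k)) *
    (qPochhammer b p k * qPochhammer (p / b) p k * qPochhammer a p (2 * k) * p ^ k ^ 2 /
      (qPochhammer p p (2 * k) * qPochhammer (a * p ^ 3 / b) (p ^ 3) k *
        qPochhammer (a * b * p ^ 2) (p ^ 3) k))

/-- The antidifference used for the shift `a ↦ a p³`. -/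
def cubicAntidiff (p a b : K) (k : ℕ) : K :=
  -(a * p) * (1 - (p ^ k) ^ 2) * (1 - (p ^ k) ^ 2 / p) *
    (qPochhammer b p k * qPochhammer (p / b) p k * qPochhammer a p (2 * k) * p ^ k ^ 2 /
      (qPochhammer p p (2 * k) * qPochhammer (a * p ^ 3 / b) (p ^ 3) k *
        qPochhammer (a * b * p ^ 2) (p ^ 3) k))

theorem cubicTerm_shift_sub {p a b : K} (hp : p ≠ 0) (hb : b ≠ 0)
    (hpp : ∀ j, 0 < j → p ^ j ≠ 1)
    (ha1 : ∀ j : ℕ, a * p ^ 3 / b * (p ^ 3) ^ j ≠ 1)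
    (ha2 : ∀ j : ℕ, a * b * p ^ 2 * (p ^ 3) ^ j ≠ 1) (k : ℕ) :
    (1 - a) * (1 - a * p) * (1 - a * p ^ 2) /
        ((1 - a * p ^ 3 / b) * (1 - a * b * p ^ 2)) * cubicTerm p (a * p ^ 3) b k -
      (1 - a * p) * cubicTerm p a b k = cubicAntidiff p a b (k + 1) - cubicAntidiff p a b k := by
  have hU0 : 1 - a * p ^ 3 / b ≠ 0 := sub_ne_zero.2 (by simpa using (ha1 0).symm)
  have hV0 : 1 - a * b * p ^ 2 ≠ 0 := sub_ne_zero.2 (by simpa using (ha2 0).symm)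
  have hUk : 1 - a * p ^ 3 / b * (p ^ 3) ^ k ≠ 0 := sub_ne_zero.2 (ha1 k).symm
  have hVk : 1 - a * b * p ^ 2 * (p ^ 3) ^ k ≠ 0 := sub_ne_zero.2 (ha2 k).symm
  have hQ : qPochhammer p p (2 * k) ≠ 0 :=
    qPochhammer_ne_zero fun j _ => by rw [← pow_succ']; exact hpp _ (Nat.succ_pos _)
  have hQ1 : 1 - p * p ^ (2 * k) ≠ 0 :=
    sub_ne_zero.2 (by rw [← pow_succ']; exact (hpp _ (Nat.succ_pos _)).symm)
  have hQ2 : 1 - p * p ^ (2 * k + 1) ≠ 0 :=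
    sub_ne_zero.2 (by rw [← pow_succ']; exact (hpp _ (Nat.succ_pos _)).symm)
  have hU : qPochhammer (a * p ^ 3 / b) (p ^ 3) k ≠ 0 := qPochhammer_ne_zero fun j _ => ha1 j
  have hV : qPochhammer (a * b * p ^ 2) (p ^ 3) k ≠ 0 := qPochhammer_ne_zero fun j _ => ha2 j
  have eA := one_sub_mul_qPochhammer_three a p (2 * k)
  have eU : qPochhammer (a * p ^ 3 * p ^ 3 / b) (p ^ 3) k =
      qPochhammer (a * p ^ 3 / b) (p ^ 3) k * (1 - a * p ^ 3 / b * (p ^ 3) ^ k) /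
        (1 - a * p ^ 3 / b) := by
    rw [eq_div_iff hU0, ← one_sub_mul_qPochhammer, mul_comm]; congr 2; ring
  have eV : qPochhammer (a * p ^ 3 * b * p ^ 2) (p ^ 3) k =
      qPochhammer (a * b * p ^ 2) (p ^ 3) k * (1 - a * b * p ^ 2 * (p ^ 3) ^ k) /
        (1 - a * b * p ^ 2) := by
    rw [eq_div_iff hV0, ← one_sub_mul_qPochhammer, mul_comm]; congr 2; ring
  simp only [cubicTerm, cubicAntidiff, eU, eV]
  rw [show 2 * (k + 1) = 2 * k + 1 + 1 by ring]
  simp only [qPochhammer_succ]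
  generalize qPochhammer b p k = B
  generalize qPochhammer (p / b) p k = B'
  generalize qPochhammer a p (2 * k) = A at *
  generalize qPochhammer (a * p ^ 3) p (2 * k) = A' at *
  generalize qPochhammer p p (2 * k) = Q at *
  generalize qPochhammer (a * p ^ 3 / b) (p ^ 3) k = U at *
  generalize qPochhammer (a * b * p ^ 2) (p ^ 3) k = V at *
  have e1 : p ^ (k + 1) ^ 2 = p ^ k ^ 2 * (p ^ k) ^ 2 * p := by ring
  have e2 : p ^ (2 * k) = (p ^ k) ^ 2 := by ring
  have e3 : (p ^ 3) ^ k = (p ^ k) ^ 3 := by ring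
  have e4 : p ^ (4 * k) = (p ^ k) ^ 4 := by ring
  simp only [pow_succ p (2 * k), pow_succ p (2 * k + 1), pow_succ p k, e1, e2, e3, e4] at *
  generalize p ^ k ^ 2 = s at *
  generalize p ^ k = x at *
  -- Dividing by the common factor of all four terms, with `x = p ^ k`, reduces telescoping to this
  -- rational identity. The factors `(1 - x²)(1 - x²/p)` of the antidifference cancel, at `k + 1`,
  -- the two new factors of `(p; p)_{2k+2}`.
  have key : (1 - a * p ^ 3 * x ^ 4) * ((1 - a * x ^ 2) * (1 - a * (x ^ 2 * p)) *
        (1 - a * (x ^ 2 * p * p))) /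
        ((1 - a * p ^ 3 / b * x ^ 3) * (1 - a * b * p ^ 2 * x ^ 3)) -
      (1 - a * p) * (1 - a * x ^ 4) =
      -(a * p) * ((1 - b * x) * (1 - p / b * x) * (1 - a * x ^ 2) * (1 - a * (x ^ 2 * p)) *
        (x ^ 2 * p) / ((1 - a * p ^ 3 / b * x ^ 3) * (1 - a * b * p ^ 2 * x ^ 3)) -
        (1 - x ^ 2) * (1 - x ^ 2 / p)) := by
    have aux (N M D Z Y e : K) (hD : D ≠ 0) (h : N - Z * D = e * (M - Y * D)) :
        N / D - Z = e * (M / D - Y) := by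
      field_simp
      linear_combination h
    refine aux _ _ _ _ _ _ (mul_ne_zero hUk hVk) ?_
    field_simp
    ring
  have l1 : (1 - a) * (1 - a * p) * (1 - a * p ^ 2) /
        ((1 - a * p ^ 3 / b) * (1 - a * b * p ^ 2)) *
      ((1 - a * p ^ 3 * x ^ 4) * (B * B' * A' * s /
        (Q * (U * (1 - a * p ^ 3 / b * x ^ 3) / (1 - a * p ^ 3 / b)) *
          (V * (1 - a * b * p ^ 2 * x ^ 3) / (1 - a * b * p ^ 2))))) =
      (B * B' * A * s / (Q * U * V)) * ((1 - a * p ^ 3 * x ^ 4) *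
        ((1 - a * x ^ 2) * (1 - a * (x ^ 2 * p)) *
        (1 - a * (x ^ 2 * p * p))) /
        ((1 - a * p ^ 3 / b * x ^ 3) * (1 - a * b * p ^ 2 * x ^ 3))) := by
    generalize 1 - a * p ^ 3 / b = u0 at *
    generalize 1 - a * b * p ^ 2 = v0 at *
    generalize 1 - a * p ^ 3 / b * x ^ 3 = uk at *
    generalize 1 - a * b * p ^ 2 * x ^ 3 = vk at *
    generalize 1 - a * p ^ 3 * x ^ 4 = w at *
    field_simp
    linear_combination (w * B * B' * s) * eA
  have l2 : -(a * p) * (1 - (x * p) ^ 2) * (1 - (x * p) ^ 2 / p) *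
      (B * (1 - b * x) * (B' * (1 - p / b * x)) *
        (A * (1 - a * x ^ 2) * (1 - a * (x ^ 2 * p))) * (s * x ^ 2 * p) /
        (Q * (1 - p * x ^ 2) * (1 - p * (x ^ 2 * p)) * (U * (1 - a * p ^ 3 / b * x ^ 3)) *
          (V * (1 - a * b * p ^ 2 * x ^ 3)))) =
      (B * B' * A * s / (Q * U * V)) * (-(a * p) * ((1 - b * x) * (1 - p / b * x) *
        (1 - a * x ^ 2) * (1 - a * (x ^ 2 * p)) *
        (x ^ 2 * p) / ((1 - a * p ^ 3 / b * x ^ 3) * (1 - a * b * p ^ 2 * x ^ 3)))) := by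
    have : (1 - (x * p) ^ 2 / p) = 1 - p * x ^ 2 := by field_simp
    rw [this, show (x * p) ^ 2 = p * (x ^ 2 * p) by ring]
    have aux (c q₁ q₂ x₁ x₂ x₃ x₄ t u v : K) (h₁ : q₁ ≠ 0) (h₂ : q₂ ≠ 0) (hu : u ≠ 0)
        (hv : v ≠ 0) :
        c * q₂ * q₁ * (B * x₁ * (B' * x₂) * (A * x₃ * x₄) * t /
          (Q * q₁ * q₂ * (U * u) * (V * v))) =
        B * B' * A / (Q * U * V) * (c * (x₁ * x₂ * x₃ * x₄ * t / (u * v))) := by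
      field_simp
    rw [aux _ _ _ _ _ _ _ _ _ _ hQ1 hQ2 hUk hVk]
    ring
  rw [l1, l2]
  linear_combination (B * B' * A * s / (Q * U * V)) * key

theorem cubicTerm_eq_zero {p a b : K} {m k : ℕ} (hb : b * p ^ m = 1) (hk : m < k) :
    cubicTerm p a b k = 0 := by
  simp [cubicTerm, qPochhammer_eq_zero hk hb]

/-- The functional equation of the terminating sum under `a ↦ a p³`. -/
theorem sum_cubicTerm_shift {p a b : K} {m : ℕ} (hp : p ≠ 0) (hb : b * p ^ m = 1)
    (hpp : ∀ j, 0 < j → p ^ j ≠ 1)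
    (ha : a * p ≠ 1)
    (ha1 : ∀ j : ℕ, a * p ^ 3 / b * (p ^ 3) ^ j ≠ 1)
    (ha2 : ∀ j : ℕ, a * b * p ^ 2 * (p ^ 3) ^ j ≠ 1) :
    (1 - a) * (1 - a * p ^ 2) * ∑ k ∈ Finset.range (m + 1), cubicTerm p (a * p ^ 3) b k =
      (1 - a * p ^ 3 / b) * (1 - a * b * p ^ 2) *
        ∑ k ∈ Finset.range (m + 1), cubicTerm p a b k := by
  have hb0 : b ≠ 0 := left_ne_zero_of_mul_eq_one hb
  have hU0 : 1 - a * p ^ 3 / b ≠ 0 := sub_ne_zero.2 (by simpa using (ha1 0).symm)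
  have hV0 : 1 - a * b * p ^ 2 ≠ 0 := sub_ne_zero.2 (by simpa using (ha2 0).symm)
  have ha' : 1 - a * p ≠ 0 := sub_ne_zero.2 ha.symm
  have h := Finset.sum_congr (rfl : Finset.range (m + 1) = _)
    fun k _ => cubicTerm_shift_sub hp hb0 hpp ha1 ha2 k
  rw [Finset.sum_sub_distrib, ← Finset.mul_sum, ← Finset.mul_sum, Finset.sum_range_sub] at h
  -- The lower end vanishes through `1 - (p ^ 0) ^ 2`, the upper one because `(b; p)_{m+1}` contains
  -- `1 - b p ^ m = 0`.
  have hz : cubicAntidiff p a b (m + 1) - cubicAntidiff p a b 0 = 0 := by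
    simp [cubicAntidiff, qPochhammer_eq_zero (Nat.lt_succ_self m) hb]
  rw [hz] at h
  generalize ∑ k ∈ Finset.range (m + 1), cubicTerm p (a * p ^ 3) b k = S at *
  generalize ∑ k ∈ Finset.range (m + 1), cubicTerm p a b k = S' at *
  generalize 1 - a * p ^ 3 / b = u at *
  generalize 1 - a * b * p ^ 2 = v at *
  generalize 1 - a * p = w at *
  field_simp at h
  rw [mul_zero] at h
  linear_combination (mul_eq_zero.1 h).resolve_left ha'

end Telescoping
-- The constant term `a = 0` and its recursion in `m`
section ConstantTerm

variable {K : Type*} [Field K]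

/-- The `k`-th coefficient of the bibasic series, which is its `k`-th term at `a = 0`. -/
def cubicCoeff (p b : K) (k : ℕ) : K :=
  qPochhammer b p k * qPochhammer (p / b) p k * p ^ k ^ 2 / qPochhammer p p (2 * k)

theorem cubicCoeff_eq_zero {p b : K} {m k : ℕ} (hb : b * p ^ m = 1) (hk : m < k) :
    cubicCoeff p b k = 0 := by
  simp [cubicCoeff, qPochhammer_eq_zero hk hb]

/-- The antidifference used for the shift `b ↦ b p³` at `a = 0`. -/
def cubicCoeffAntidiff (p b : K) (k : ℕ) : K :=
  (1 - (p ^ k) ^ 2) * (1 - (p ^ k) ^ 2 / p) *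
    (qPochhammer b p k * qPochhammer (p / (b * p ^ 3)) p k * p ^ k ^ 2 / qPochhammer p p (2 * k))

theorem cubicCoeff_shift_sub {p b : K} (hp : p ≠ 0) (hb : b ≠ 0)
    (hpp : ∀ j, 0 < j → p ^ j ≠ 1) (k : ℕ) :
    (1 - p / (b * p ^ 3)) * (1 - p / (b * p ^ 3) * p) * (1 - p / (b * p ^ 3) * p ^ 2) *
        b ^ 2 * p ^ 2 * cubicCoeff p b k -
      (1 - b) * (1 - b * p) * (1 - b * p ^ 2) * cubicCoeff p (b * p ^ 3) k =
    (1 - b ^ 2 * p ^ 2) * (cubicCoeffAntidiff p b (k + 1) - cubicCoeffAntidiff p b k) := by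
  have hQ : qPochhammer p p (2 * k) ≠ 0 :=
    qPochhammer_ne_zero fun j _ => by rw [← pow_succ']; exact hpp _ (Nat.succ_pos _)
  have hQ1 : 1 - p * p ^ (2 * k) ≠ 0 :=
    sub_ne_zero.2 (by rw [← pow_succ']; exact (hpp _ (Nat.succ_pos _)).symm)
  have hQ2 : 1 - p * p ^ (2 * k + 1) ≠ 0 :=
    sub_ne_zero.2 (by rw [← pow_succ']; exact (hpp _ (Nat.succ_pos _)).symm)
  have eB := one_sub_mul_qPochhammer_three b p k
  have eC := one_sub_mul_qPochhammer_three (p / (b * p ^ 3)) p k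
  rw [show p / (b * p ^ 3) * p ^ 3 = p / b by field_simp] at eC
  simp only [cubicCoeff, cubicCoeffAntidiff]
  rw [show 2 * (k + 1) = 2 * k + 1 + 1 by ring]
  simp only [qPochhammer_succ]
  generalize qPochhammer b p k = B at *
  generalize qPochhammer (b * p ^ 3) p k = B' at *
  generalize qPochhammer (p / (b * p ^ 3)) p k = C at *
  generalize qPochhammer (p / b) p k = C' at *
  generalize qPochhammer p p (2 * k) = Q at *
  have e1 : p ^ (k + 1) ^ 2 = p ^ k ^ 2 * (p ^ k) ^ 2 * p := by ring
  have e2 : p ^ (2 * k) = (p ^ k) ^ 2 := by ring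
  have e3 : p ^ (k + 2) = p ^ k * p ^ 2 := by ring
  simp only [pow_succ p (2 * k), pow_succ p k, e1, e2, e3] at *
  generalize p ^ k ^ 2 = s at *
  generalize p ^ k = x at *
  have l1 : (1 - p / (b * p ^ 3)) * (1 - p / (b * p ^ 3) * p) * (1 - p / (b * p ^ 3) * p ^ 2) *
        b ^ 2 * p ^ 2 * (B * C' * s / Q) = B * C * s / Q * ((1 - p / (b * p ^ 3) * x) *
        (1 - p / (b * p ^ 3) * (x * p)) * (1 - p / (b * p ^ 3) * (x * p ^ 2)) *
        b ^ 2 * p ^ 2) := by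
    linear_combination (b ^ 2 * p ^ 2 * B * s / Q) * eC
  have l2 : (1 - b) * (1 - b * p) * (1 - b * p ^ 2) * (B' * C * s / Q) =
      B * C * s / Q * ((1 - b * x) * (1 - b * (x * p)) * (1 - b * (x * p ^ 2))) := by
    linear_combination (C * s / Q) * eB
  have l3 : (1 - (x * p) ^ 2) * (1 - (x * p) ^ 2 / p) *
      (B * (1 - b * x) * (C * (1 - p / (b * p ^ 3) * x)) * (s * x ^ 2 * p) /
        (Q * (1 - p * x ^ 2) * (1 - p * (x ^ 2 * p)))) =
      B * C * s / Q * ((1 - b * x) * (1 - p / (b * p ^ 3) * x) * (x ^ 2 * p)) := by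
    have : (1 - (x * p) ^ 2 / p) = 1 - p * x ^ 2 := by field_simp
    rw [this, show (x * p) ^ 2 = p * (x ^ 2 * p) by ring]
    generalize 1 - p * x ^ 2 = q1 at *
    generalize 1 - p * (x ^ 2 * p) = q2 at *
    field_simp
  rw [l1, l2, l3]
  have key : (1 - p / (b * p ^ 3) * x) *
        (1 - p / (b * p ^ 3) * (x * p)) * (1 - p / (b * p ^ 3) * (x * p ^ 2)) *
        b ^ 2 * p ^ 2 - (1 - b * x) * (1 - b * (x * p)) * (1 - b * (x * p ^ 2)) =
      -(1 - b ^ 2 * p ^ 2) * ((1 - x ^ 2) * (1 - x ^ 2 / p) -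
        (1 - b * x) * (1 - p / (b * p ^ 3) * x) * (x ^ 2 * p)) := by
    field_simp
    ring
  linear_combination (B * C * s / Q) * key

/-- The sum at `a = 0`, `b = p⁻ᵐ`. -/
def cubicConst (p : K) (m : ℕ) : K :=
  ∑ k ∈ Finset.range (m + 1), cubicCoeff p (p ^ m)⁻¹ k

theorem cubicConst_add_three {p : K} (hp : p ≠ 0) (hpp : ∀ j, 0 < j → p ^ j ≠ 1) (m : ℕ) :
    cubicConst p (m + 3) = -(p ^ (m + 2))⁻¹ * cubicConst p m := by
  have hb : (p ^ (m + 3))⁻¹ * p ^ (m + 3) = 1 := inv_mul_cancel₀ (pow_ne_zero _ hp)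
  have hb' : (p ^ (m + 3))⁻¹ * p ^ 3 = (p ^ m)⁻¹ := by
    rw [pow_add]; field_simp
  have hm : (p ^ m)⁻¹ * p ^ m = 1 := inv_mul_cancel₀ (pow_ne_zero _ hp)
  have h := Finset.sum_congr (rfl : Finset.range (m + 3 + 1) = _)
    fun k _ => cubicCoeff_shift_sub hp (left_ne_zero_of_mul_eq_one hb) hpp k
  have hz : cubicCoeffAntidiff p (p ^ (m + 3))⁻¹ (m + 3 + 1) -
      cubicCoeffAntidiff p (p ^ (m + 3))⁻¹ 0 = 0 := by
    simp [cubicCoeffAntidiff, qPochhammer_eq_zero (Nat.lt_succ_self (m + 3)) hb]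
  have hs : ∑ k ∈ Finset.range (m + 3 + 1), cubicCoeff p (p ^ m)⁻¹ k = cubicConst p m := by
    refine (Finset.sum_subset (Finset.range_mono (by omega)) fun k _ hk => ?_).symm
    exact cubicCoeff_eq_zero hm (by simpa using hk)
  rw [Finset.sum_sub_distrib, ← Finset.mul_sum, ← Finset.mul_sum, ← Finset.mul_sum,
    Finset.sum_range_sub, hz, hb', hs, mul_zero] at h
  change _ * cubicConst p (m + 3) - _ = _ at h
  generalize cubicConst p (m + 3) = S at *
  generalize cubicConst p m = S' at *
  have h1 : p ^ (m + 1) - 1 ≠ 0 := sub_ne_zero.2 (hpp _ (by omega))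
  have h2 : p ^ (m + 2) - 1 ≠ 0 := sub_ne_zero.2 (hpp _ (by omega))
  have h3 : p ^ (m + 3) - 1 ≠ 0 := sub_ne_zero.2 (hpp _ (by omega))

  have hx : p ^ m ≠ 0 := pow_ne_zero _ hp
  simp only [pow_add, pow_one] at *
  generalize p ^ m = x at *
  -- For `b = p^-(m+3)`, both triple products in the telescoped relation are, up to sign and powers
  -- of `p`, `(1 - p^(m+1))(1 - p^(m+2))(1 - p^(m+3))`, which is nonzero and cancels.
  have hS : (x * p - 1) * (x * p ^ 2 - 1) * (x * p ^ 3 - 1) * (x * p ^ 2 * S + S') = 0 := by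
    field_simp at h
    rw [mul_zero] at h
    linear_combination -h
  have hS' : x * p ^ 2 * S + S' = 0 := by simpa [h1, h2, h3] using hS
  field_simp
  linear_combination hS'

theorem cubicConst_zero (p : K) : cubicConst p 0 = 1 := by
  simp [cubicConst, cubicCoeff, qPochhammer_zero]

theorem cubicConst_one {p : K} (hp : p ≠ 0) (hpp : ∀ j, 0 < j → p ^ j ≠ 1) :
    cubicConst p 1 = 0 := by
  have h1 : 1 - p ≠ 0 := sub_ne_zero.2 (by simpa using (hpp 1 (by omega)).symm)
  have h2 : 1 - p ^ 2 ≠ 0 := sub_ne_zero.2 (by simpa using (hpp 2 (by omega)).symm)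
  simp [cubicConst, cubicCoeff, qPochhammer, Finset.sum_range_succ, Finset.prod_range_succ]
  rw [← pow_two]
  field_simp
  ring

theorem cubicConst_two {p : K} (hp : p ≠ 0) (hpp : ∀ j, 0 < j → p ^ j ≠ 1) :
    cubicConst p 2 = -p⁻¹ := by
  have h1 : 1 - p ≠ 0 := sub_ne_zero.2 (by simpa using (hpp 1 (by omega)).symm)
  have h2 : 1 - p ^ 2 ≠ 0 := sub_ne_zero.2 (by simpa using (hpp 2 (by omega)).symm)
  have h3 : 1 - p ^ 3 ≠ 0 := sub_ne_zero.2 (by simpa using (hpp 3 (by omega)).symm)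
  have h4 : 1 - p ^ 4 ≠ 0 := sub_ne_zero.2 (by simpa using (hpp 4 (by omega)).symm)
  simp [cubicConst, cubicCoeff, qPochhammer, Finset.sum_range_succ, Finset.prod_range_succ]
  rw [← pow_two, ← pow_succ', ← pow_succ']
  field_simp
  ring

theorem cubicConst_three_mul_add_one {p : K} (hp : p ≠ 0) (hpp : ∀ j, 0 < j → p ^ j ≠ 1)
    (r : ℕ) : cubicConst p (3 * r + 1) = 0 := by
  induction r with
  | zero => exact cubicConst_one hp hpp
  | succ r ih =>
    rw [show 3 * (r + 1) + 1 = 3 * r + 1 + 3 by ring, cubicConst_add_three hp hpp, ih, mul_zero]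

end ConstantTerm

/-! ### Uniqueness for the functional equation; clearing denominators -/

section Polynomial

open Polynomial

variable {K : Type*} [Field K]

/-- If all coefficients of `N` below degree `j > 0` vanish, the coefficient of `X ^ j` in the
equation reads `c ^ j * N_j = N_j`, which forces `N_j = 0`. -/
theorem Polynomial.eq_zero_of_comp_mul_eq {c : K} (hc : ∀ j, 0 < j → c ^ j ≠ 1)
    {N u v : K[X]} (hu : u.coeff 0 = 1) (hv : v.coeff 0 = 1)
    (h : N.comp (C c * X) * u = N * v) (h0 : N.coeff 0 = 0) : N = 0 := by
  suffices ∀ j, N.coeff j = 0 from Polynomial.ext fun j => by simpa using this j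
  intro j
  induction j using Nat.strong_induction_on with
  | _ j ih =>
    rcases Nat.eq_zero_or_pos j with rfl | hj
    · exact h0
    have key := congrArg (fun f => f.coeff j) h
    simp only [coeff_mul] at key
    rw [Finset.sum_eq_single (j, 0), Finset.sum_eq_single (j, 0)] at key
    · simp only [comp_C_mul_X_coeff, hu, hv, mul_one] at key
      by_contra hne
      exact hc j hj (mul_left_cancel₀ hne (by rw [key, mul_one]))
    · rintro ⟨x, y⟩ hx hne
      rw [Finset.HasAntidiagonal.mem_antidiagonal] at hx
      simp only [ne_eq, Prod.mk.injEq, not_and] at hx hne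
      rw [ih x (by omega), zero_mul]
    · exact fun hx => absurd (by simp) hx
    · rintro ⟨x, y⟩ hx hne
      rw [Finset.HasAntidiagonal.mem_antidiagonal] at hx
      simp only [ne_eq, Prod.mk.injEq, not_and] at hx hne
      rw [comp_C_mul_X_coeff, ih x (by omega), zero_mul, zero_mul]
    · exact fun hx => absurd (by simp) hx

theorem Polynomial.eq_C_mul_of_comp_mul_eq {c : K} (hc : ∀ j, 0 < j → c ^ j ≠ 1)
    {N W u v : K[X]} (hu : u.coeff 0 = 1) (hv : v.coeff 0 = 1)
    (h : N.comp (C c * X) * u = N * v) (hW : W.comp (C c * X) * u = W * v)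
    (hW0 : W.coeff 0 = 1) : N = C (N.coeff 0) * W := by
  rw [← sub_eq_zero]
  refine eq_zero_of_comp_mul_eq hc hu hv ?_ (by simp [hW0])
  rw [sub_comp, mul_comp, C_comp]
  linear_combination h - C (N.coeff 0) * hW

/-- The `q`-Pochhammer symbol `(c X; q)_k` as a polynomial in `X`. -/
noncomputable def qPochhammerPoly (c q : K) (k : ℕ) : K[X] :=
  ∏ j ∈ Finset.range k, (1 - C (c * q ^ j) * X)

theorem eval_qPochhammerPoly (c q a : K) (k : ℕ) :
    (qPochhammerPoly c q k).eval a = qPochhammer (a * c) q k := by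
  simp only [qPochhammerPoly, qPochhammer, eval_prod]
  refine Finset.prod_congr rfl fun j _ => ?_
  simp only [eval_sub, eval_one, eval_mul, eval_C, eval_X]
  ring

theorem coeff_zero_qPochhammerPoly (c q : K) (k : ℕ) : (qPochhammerPoly c q k).coeff 0 = 1 := by
  rw [coeff_zero_eq_eval_zero, eval_qPochhammerPoly, zero_mul]
  simp [qPochhammer]

theorem qPochhammerPoly_comp_mul (c q : K) (k : ℕ) :
    (qPochhammerPoly c q k).comp (C q * X) * (1 - C c * X) =
      qPochhammerPoly c q k * (1 - C (c * q ^ k) * X) := by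
  have : (qPochhammerPoly c q k).comp (C q * X) =
      ∏ j ∈ Finset.range k, (1 - C (c * q ^ (j + 1)) * X) := by
    simp only [qPochhammerPoly, prod_comp]
    refine Finset.prod_congr rfl fun j _ => ?_
    simp only [sub_comp, one_comp, mul_comp, C_comp, X_comp, pow_succ, map_mul]
    ring
  rw [this, qPochhammerPoly, ← Finset.prod_range_succ (fun j => 1 - C (c * q ^ j) * X),
    Finset.prod_range_succ']
  simp

/-- The terminating sum times its common denominator, as a polynomial in `a`. -/
noncomputable def cubicPoly (p b : K) (m : ℕ) : K[X] :=
  ∑ k ∈ Finset.range (m + 1), C (cubicCoeff p b k) * (1 - C (p ^ (4 * k)) * X) *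
    qPochhammerPoly 1 p (2 * k) * qPochhammerPoly (p ^ 3 / b * (p ^ 3) ^ k) (p ^ 3) (m - k) *
    qPochhammerPoly (b * p ^ 2 * (p ^ 3) ^ k) (p ^ 3) (m - k)

theorem coeff_zero_cubicPoly (p : K) (m : ℕ) :
    (cubicPoly p (p ^ m)⁻¹ m).coeff 0 = cubicConst p m := by
  simp [cubicPoly, cubicConst, mul_coeff_zero, coeff_zero_qPochhammerPoly]

theorem eval_cubicPoly {p a b : K} (m : ℕ)
    (ha1 : ∀ j : ℕ, a * p ^ 3 / b * (p ^ 3) ^ j ≠ 1)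
    (ha2 : ∀ j : ℕ, a * b * p ^ 2 * (p ^ 3) ^ j ≠ 1) :
    (cubicPoly p b m).eval a = qPochhammer (a * p ^ 3 / b) (p ^ 3) m *
      qPochhammer (a * b * p ^ 2) (p ^ 3) m *
        ∑ k ∈ Finset.range (m + 1), cubicTerm p a b k := by
  simp only [cubicPoly, eval_finsetSum, Finset.mul_sum]
  refine Finset.sum_congr rfl fun k hk => ?_
  have hk' : k + (m - k) = m := by have := Finset.mem_range.1 hk; omega
  have h1 := qPochhammer_add (a * p ^ 3 / b) (p ^ 3) k (m - k)
  have h2 := qPochhammer_add (a * b * p ^ 2) (p ^ 3) k (m - k)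
  rw [hk'] at h1 h2
  have hU : qPochhammer (a * p ^ 3 / b) (p ^ 3) k ≠ 0 := qPochhammer_ne_zero fun j _ => ha1 j
  have hV : qPochhammer (a * b * p ^ 2) (p ^ 3) k ≠ 0 := qPochhammer_ne_zero fun j _ => ha2 j
  simp only [eval_mul, eval_C, eval_sub, eval_one, eval_X, eval_qPochhammerPoly, h1, h2,
    cubicTerm, cubicCoeff, mul_one]
  rw [show a * (p ^ 3 / b * (p ^ 3) ^ k) = a * p ^ 3 / b * (p ^ 3) ^ k by ring,
    show a * (b * p ^ 2 * (p ^ 3) ^ k) = a * b * p ^ 2 * (p ^ 3) ^ k by ring,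
    mul_comm (p ^ (4 * k)) a]
  generalize qPochhammer (a * p ^ 3 / b) (p ^ 3) k = U at *
  generalize qPochhammer (a * b * p ^ 2) (p ^ 3) k = V at *
  field_simp

end Polynomial
-- Solving the equation and evaluating at `a = q`
section Evaluation

open Polynomial

variable {K : Type*} [Field K]

theorem pow_ne_pow_of_ne {q : K} (hq0 : q ≠ 0) (hq : ∀ m : ℕ, 0 < m → q ^ m ≠ 1) {i j : ℕ}
    (hij : i ≠ j) : q ^ i ≠ q ^ j := by
  intro h
  wlog hlt : i < j generalizing i j
  · exact this hij.symm h.symm (by omega)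
  obtain ⟨d, rfl⟩ := Nat.exists_eq_add_of_lt hlt
  rw [add_assoc, pow_add] at h
  exact hq (d + 1) (Nat.succ_pos d) (mul_left_cancel₀ (pow_ne_zero i hq0) (by rw [← h, mul_one]))

/-- The left side is `q` to the odd, hence nonzero, exponent `6i + 5 + 6j - 2m`: no denominator
vanishes at `a = q ^ (6i + 1)`. -/
theorem odd_pow_mul_ne_one {q : K} (hq0 : q ≠ 0) (hq : ∀ m : ℕ, 0 < m → q ^ m ≠ 1)
    (m i j : ℕ) :
    q ^ (6 * i + 1) * ((q ^ 2) ^ m)⁻¹ * (q ^ 2) ^ 2 * ((q ^ 2) ^ 3) ^ j ≠ 1 := by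
  intro h
  apply pow_ne_pow_of_ne hq0 hq (show 6 * i + 5 + 6 * j ≠ 2 * m by omega)
  field_simp at h
  rw [← pow_mul q 2 m] at h
  rw [← h]
  ring

theorem odd_pow_div_ne_one {q : K} (hq : ∀ m : ℕ, 0 < m → q ^ m ≠ 1) (m i j : ℕ) :
    q ^ (6 * i + 1) * (q ^ 2) ^ 3 / ((q ^ 2) ^ m)⁻¹ * ((q ^ 2) ^ 3) ^ j ≠ 1 := by
  rw [div_inv_eq_mul]
  convert hq (6 * i + 1 + 6 + 2 * m + 6 * j) (by omega) using 1
  ring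

theorem sq_pow_ne_one {q : K} (hq : ∀ m : ℕ, 0 < m → q ^ m ≠ 1) (j : ℕ) (hj : 0 < j) :
    (q ^ 2) ^ j ≠ 1 := by
  rw [← pow_mul]
  exact hq _ (by omega)

theorem cubicPoly_comp_mul {q : K} (hq0 : q ≠ 0) (hq : ∀ m : ℕ, 0 < m → q ^ m ≠ 1) (m : ℕ) :
    (cubicPoly (q ^ 2) ((q ^ 2) ^ m)⁻¹ m).comp (C ((q ^ 2) ^ 3) * X) *
        ((1 - X) * (1 - C ((q ^ 2) ^ 2) * X)) =
      cubicPoly (q ^ 2) ((q ^ 2) ^ m)⁻¹ m *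
        ((1 - C ((q ^ 2) ^ (3 + 4 * m)) * X) * (1 - C ((q ^ 2) ^ (2 + 2 * m)) * X)) := by
  have hp : q ^ 2 ≠ 0 := pow_ne_zero _ hq0
  have hb : ((q ^ 2) ^ m)⁻¹ * (q ^ 2) ^ m = 1 := inv_mul_cancel₀ (pow_ne_zero _ hp)
  -- The sample points `q ^ (6i + 1)` are infinitely many, avoid all poles, and are stable under `a
  -- ↦ a p³ = a q⁶`.
  refine Polynomial.eq_of_infinite_eval_eq _ _ (Set.Infinite.mono ?_
    (Set.infinite_range_of_injective (f := fun i : ℕ => q ^ (6 * i + 1)) ?_))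
  · rintro _ ⟨i, rfl⟩
    have hi : q ^ (6 * i + 1) * (q ^ 2) ^ 3 = q ^ (6 * (i + 1) + 1) := by ring
    have ha : q ^ (6 * i + 1) * q ^ 2 ≠ 1 := by
      rw [← pow_add]; exact hq _ (by omega)
    have key := sum_cubicTerm_shift hp hb (sq_pow_ne_one hq) ha (odd_pow_div_ne_one hq m i)
      (odd_pow_mul_ne_one hq0 hq m i)
    have h1 := eval_cubicPoly m (odd_pow_div_ne_one hq m i) (odd_pow_mul_ne_one hq0 hq m i)
    have h2 := eval_cubicPoly m (odd_pow_div_ne_one hq m (i + 1))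
      (odd_pow_mul_ne_one hq0 hq m (i + 1))
    have hU := one_sub_mul_qPochhammer (q ^ (6 * i + 1) * (q ^ 2) ^ 3 / ((q ^ 2) ^ m)⁻¹)
      ((q ^ 2) ^ 3) m
    have hV := one_sub_mul_qPochhammer (q ^ (6 * i + 1) * ((q ^ 2) ^ m)⁻¹ * (q ^ 2) ^ 2)
      ((q ^ 2) ^ 3) m
    have hU' : q ^ (6 * i + 1) * (q ^ 2) ^ 3 / ((q ^ 2) ^ m)⁻¹ * ((q ^ 2) ^ 3) ^ m =
        (q ^ 2) ^ (3 + 4 * m) * q ^ (6 * i + 1) := by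
      rw [div_inv_eq_mul]; ring
    have hV' : q ^ (6 * i + 1) * ((q ^ 2) ^ m)⁻¹ * (q ^ 2) ^ 2 * ((q ^ 2) ^ 3) ^ m =
        (q ^ 2) ^ (2 + 2 * m) * q ^ (6 * i + 1) := by
      rw [show ((q ^ 2) ^ 3) ^ m = (q ^ 2) ^ m * (q ^ 2) ^ m * (q ^ 2) ^ m by ring]
      field_simp
      ring
    rw [hU'] at hU
    rw [hV'] at hV
    rw [div_mul_eq_mul_div] at hU
    rw [show q ^ (6 * i + 1) * ((q ^ 2) ^ m)⁻¹ * (q ^ 2) ^ 2 * (q ^ 2) ^ 3 =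
      q ^ (6 * i + 1) * (q ^ 2) ^ 3 * ((q ^ 2) ^ m)⁻¹ * (q ^ 2) ^ 2 by ring] at hV
    rw [← hi] at h2
    simp only [Set.mem_ofPred_eq, eval_mul, eval_comp, eval_sub, eval_one, eval_C, eval_X]
    rw [mul_comm ((q ^ 2) ^ 3) (q ^ (6 * i + 1)), mul_comm ((q ^ 2) ^ 2) (q ^ (6 * i + 1)), h1, h2]
    generalize qPochhammer (q ^ (6 * i + 1) * (q ^ 2) ^ 3 * (q ^ 2) ^ 3 / ((q ^ 2) ^ m)⁻¹)
      ((q ^ 2) ^ 3) m = U₁ at *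
    generalize qPochhammer (q ^ (6 * i + 1) * (q ^ 2) ^ 3 * ((q ^ 2) ^ m)⁻¹ * (q ^ 2) ^ 2)
      ((q ^ 2) ^ 3) m = V₁ at *
    generalize qPochhammer (q ^ (6 * i + 1) * (q ^ 2) ^ 3 / ((q ^ 2) ^ m)⁻¹)
      ((q ^ 2) ^ 3) m = U at *
    generalize qPochhammer (q ^ (6 * i + 1) * ((q ^ 2) ^ m)⁻¹ * (q ^ 2) ^ 2)
      ((q ^ 2) ^ 3) m = V at *
    generalize ∑ k ∈ Finset.range (m + 1),
      cubicTerm (q ^ 2) (q ^ (6 * i + 1) * (q ^ 2) ^ 3) ((q ^ 2) ^ m)⁻¹ k = S₁ at *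
    generalize ∑ k ∈ Finset.range (m + 1),
      cubicTerm (q ^ 2) (q ^ (6 * i + 1)) ((q ^ 2) ^ m)⁻¹ k = S at *
    generalize 1 - q ^ (6 * i + 1) * (q ^ 2) ^ 3 / ((q ^ 2) ^ m)⁻¹ = u at *
    generalize 1 - q ^ (6 * i + 1) * ((q ^ 2) ^ m)⁻¹ * (q ^ 2) ^ 2 = v at *
    generalize 1 - (q ^ 2) ^ (3 + 4 * m) * q ^ (6 * i + 1) = t₁ at *
    generalize 1 - (q ^ 2) ^ (2 + 2 * m) * q ^ (6 * i + 1) = t₂ at *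
    linear_combination U₁ * V₁ * key + V₁ * v * S * hU + U * t₁ * S * hV
  · intro i j h
    by_contra hne
    exact pow_ne_pow_of_ne hq0 hq (show 6 * i + 1 ≠ 6 * j + 1 by omega) h

/-- The explicit solution of the functional equation of `cubicPoly`. -/
theorem qPochhammerPoly_mul_comp (p : K) (s t : ℕ) :
    (qPochhammerPoly 1 (p ^ 3) s * qPochhammerPoly (p ^ 2) (p ^ 3) t).comp (C (p ^ 3) * X) *
        ((1 - X) * (1 - C (p ^ 2) * X)) =
      qPochhammerPoly 1 (p ^ 3) s * qPochhammerPoly (p ^ 2) (p ^ 3) t *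
        ((1 - C (p ^ (3 * s)) * X) * (1 - C (p ^ (2 + 3 * t)) * X)) := by
  have h1 := qPochhammerPoly_comp_mul 1 (p ^ 3) s
  have h2 := qPochhammerPoly_comp_mul (p ^ 2) (p ^ 3) t
  rw [C_1, one_mul, one_mul, ← pow_mul] at h1
  rw [← pow_mul, ← pow_add] at h2
  rw [mul_comp, mul_mul_mul_comm, h1, h2]
  ring

/-- The value at `a = q` of the terminating sum, before removing the common denominator. -/
theorem mul_sum_cubicTerm_eq {q : K} (hq0 : q ≠ 0) (hq : ∀ m : ℕ, 0 < m → q ^ m ≠ 1)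
    (m s t : ℕ)
    (h : (3 * s = 3 + 4 * m ∧ 3 * t = 2 * m) ∨ (3 * s = 2 + 2 * m ∧ 3 * t = 1 + 4 * m)) :
    qPochhammer (q ^ (2 * m + 7)) (q ^ 6) m * qPochhammer (q ^ 5 / q ^ (2 * m)) (q ^ 6) m *
        ∑ k ∈ Finset.range (m + 1), cubicTerm (q ^ 2) q ((q ^ 2) ^ m)⁻¹ k =
      cubicConst (q ^ 2) m * (qPochhammer q (q ^ 6) s * qPochhammer (q ^ 5) (q ^ 6) t) := by
  have hN := cubicPoly_comp_mul hq0 hq m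
  have hW := qPochhammerPoly_mul_comp (q ^ 2) s t
  -- The two alternatives are the two ways to match the exponents `{3s, 2 + 3t}` with `{3 + 4m, 2 +
  -- 2m}`: the first needs `3 ∣ m`, the second `m ≡ 2 (mod 3)`.
  have hv : ((1 - C ((q ^ 2) ^ (3 * s)) * X) * (1 - C ((q ^ 2) ^ (2 + 3 * t)) * X) : K[X]) =
      (1 - C ((q ^ 2) ^ (3 + 4 * m)) * X) * (1 - C ((q ^ 2) ^ (2 + 2 * m)) * X) := by
    rcases h with ⟨h1, h2⟩ | ⟨h1, h2⟩
    · rw [h1, h2]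
    · rw [h1, h2, mul_comm, ← add_assoc]
  rw [hv] at hW
  have hmain := congrArg (eval q) (Polynomial.eq_C_mul_of_comp_mul_eq (c := (q ^ 2) ^ 3)
    (fun j hj => by rw [← pow_mul]; exact sq_pow_ne_one hq _ (by omega))
    (by simp [mul_coeff_zero]) (by simp [mul_coeff_zero]) hN hW
    (by simp [mul_coeff_zero, coeff_zero_qPochhammerPoly]))
  have h1 := eval_cubicPoly m (odd_pow_div_ne_one hq m 0) (odd_pow_mul_ne_one hq0 hq m 0)
  simp only [mul_zero, zero_add, pow_one] at h1
  rw [h1, coeff_zero_cubicPoly] at hmain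
  simp only [eval_mul, eval_C, eval_qPochhammerPoly, mul_one] at hmain
  rw [show q * (q ^ 2) ^ 3 / ((q ^ 2) ^ m)⁻¹ = q ^ (2 * m + 7) by rw [div_inv_eq_mul]; ring,
    show q * ((q ^ 2) ^ m)⁻¹ * (q ^ 2) ^ 2 = q ^ 5 / q ^ (2 * m) by rw [← pow_mul]; ring,
    show (q ^ 2) ^ 3 = q ^ 6 by ring, show q * (q ^ 2) ^ 2 = q ^ 5 by ring] at hmain
  exact hmain

theorem sum_cubicTerm_three_mul_add_one {q : K} (hq0 : q ≠ 0)
    (hq : ∀ m : ℕ, 0 < m → q ^ m ≠ 1) (r : ℕ) :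
    ∑ k ∈ Finset.range (3 * r + 1 + 1), cubicTerm (q ^ 2) q ((q ^ 2) ^ (3 * r + 1))⁻¹ k = 0 := by
  have hN := Polynomial.eq_zero_of_comp_mul_eq (c := (q ^ 2) ^ 3)
    (fun j hj => by rw [← pow_mul]; exact sq_pow_ne_one hq _ (by omega))
    (by simp [mul_coeff_zero]) (by simp [mul_coeff_zero]) (cubicPoly_comp_mul hq0 hq (3 * r + 1))
    (by rw [coeff_zero_cubicPoly, cubicConst_three_mul_add_one (pow_ne_zero _ hq0)
      (sq_pow_ne_one hq)])
  have h1 := eval_cubicPoly (3 * r + 1) (odd_pow_div_ne_one hq (3 * r + 1) 0)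
    (odd_pow_mul_ne_one hq0 hq (3 * r + 1) 0)
  rw [hN, eval_zero] at h1
  have hne := mul_ne_zero
    (qPochhammer_ne_zero (k := 3 * r + 1) fun j _ => odd_pow_div_ne_one hq (3 * r + 1) 0 j)
    (qPochhammer_ne_zero (k := 3 * r + 1) fun j _ => odd_pow_mul_ne_one hq0 hq (3 * r + 1) 0 j)
  simpa using (mul_eq_zero.1 h1.symm).resolve_left hne

/-- Stated so that the right side is the first `r` factors of the denominator `(q^(5-2m); q⁶)_m`, `m
= 3r`, and cancels there. The induction step matches the recursion with `1 - q^-(6r+1) = -q^-(6r+1)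
(1 - q^(6r+1))`. -/
theorem cubicConst_three_mul {q : K} (hq0 : q ≠ 0) (hq : ∀ m : ℕ, 0 < m → q ^ m ≠ 1) (r : ℕ) :
    q ^ (3 * r) * (cubicConst (q ^ 2) (3 * r) * qPochhammer q (q ^ 6) r) =
      qPochhammer (q ^ 5 / q ^ (2 * (3 * r))) (q ^ 6) r := by
  induction r with
  | zero => simp [cubicConst_zero, qPochhammer_zero]
  | succ r ih =>
    have h1 := qPochhammer_add (q ^ 5 / q ^ (2 * (3 * (r + 1)))) (q ^ 6) 1 r
    rw [show q ^ 5 / q ^ (2 * (3 * (r + 1))) * (q ^ 6) ^ 1 = q ^ 5 / q ^ (2 * (3 * r)) by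
      rw [show 2 * (3 * (r + 1)) = 2 * (3 * r) + 6 by ring, pow_add]; field_simp, ← ih,
      qPochhammer_one] at h1
    rw [add_comm 1 r] at h1
    rw [h1, qPochhammer_succ, show 3 * (r + 1) = 3 * r + 3 by ring,
      cubicConst_add_three (pow_ne_zero _ hq0) (sq_pow_ne_one hq)]
    have e1 : (q ^ 2) ^ (3 * r + 2) = q ^ (6 * r) * q ^ 4 := by ring
    have e2 : q ^ (2 * (3 * r + 3)) = q ^ (6 * r) * q ^ 6 := by ring
    have e3 : (q ^ 6) ^ r = q ^ (6 * r) := by ring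
    rw [e1, e2, e3, pow_add q (3 * r) 3]
    field_simp
    ring

theorem cubicConst_three_mul_add_two {q : K} (hq0 : q ≠ 0) (hq : ∀ m : ℕ, 0 < m → q ^ m ≠ 1)
    (r : ℕ) :
    q ^ (3 * r + 2) * (cubicConst (q ^ 2) (3 * r + 2) * qPochhammer (q ^ 5) (q ^ 6) r) =
      -qPochhammer (q ^ 5 / q ^ (2 * (3 * r + 2))) (q ^ 6) r := by
  induction r with
  | zero => simp [cubicConst_two (pow_ne_zero 2 hq0) (sq_pow_ne_one hq), qPochhammer_zero, hq0]
  | succ r ih =>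
    have h1 := qPochhammer_add (q ^ 5 / q ^ (2 * (3 * (r + 1) + 2))) (q ^ 6) 1 r
    rw [show q ^ 5 / q ^ (2 * (3 * (r + 1) + 2)) * (q ^ 6) ^ 1 = q ^ 5 / q ^ (2 * (3 * r + 2)) by
      rw [show 2 * (3 * (r + 1) + 2) = 2 * (3 * r + 2) + 6 by ring, pow_add]; field_simp,
      ← neg_neg (qPochhammer (q ^ 5 / q ^ (2 * (3 * r + 2))) (q ^ 6) r), ← ih,
      qPochhammer_one] at h1
    rw [add_comm 1 r] at h1
    rw [h1, qPochhammer_succ,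
      show 3 * (r + 1) + 2 = 3 * r + 2 + 3 by ring,
      cubicConst_add_three (pow_ne_zero _ hq0) (sq_pow_ne_one hq)]
    have e1 : (q ^ 2) ^ (3 * r + 2 + 2) = q ^ (6 * r) * q ^ 8 := by ring
    have e2 : q ^ (2 * (3 * r + 2 + 3)) = q ^ (6 * r) * q ^ 10 := by ring
    have e3 : (q ^ 6) ^ r = q ^ (6 * r) := by ring
    rw [e1, e2, e3, pow_add q (3 * r + 2) 3]
    field_simp
    ring

theorem qPochhammer_odd_ne_zero {q : K} (hq0 : q ≠ 0) (hq : ∀ m : ℕ, 0 < m → q ^ m ≠ 1)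
    (m k : ℕ) : qPochhammer (q ^ 5 / q ^ (2 * m)) (q ^ 6) k ≠ 0 := by
  refine qPochhammer_ne_zero fun j _ h => odd_pow_mul_ne_one hq0 hq m 0 j ?_
  rw [← h, div_eq_mul_inv]
  ring

theorem qPochhammer_pow_ne_zero {q : K} (hq : ∀ m : ℕ, 0 < m → q ^ m ≠ 1) {m : ℕ} (hm : 0 < m)
    (s k : ℕ) : qPochhammer (q ^ m) (q ^ s) k ≠ 0 := by
  refine qPochhammer_ne_zero fun j _ => ?_
  rw [← pow_mul, ← pow_add]
  exact hq _ (by omega)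

theorem sum_cubicTerm_three_mul {q : K} (hq0 : q ≠ 0) (hq : ∀ m : ℕ, 0 < m → q ^ m ≠ 1)
    (r : ℕ) :
    q ^ (3 * r) * ∑ k ∈ Finset.range (3 * r + 1), cubicTerm (q ^ 2) q ((q ^ 2) ^ (3 * r))⁻¹ k =
      1 - q ^ (6 * r + 1) := by
  have h := mul_sum_cubicTerm_eq hq0 hq (3 * r) (r + 1 + 3 * r) (2 * r)
    (Or.inl ⟨by ring, by ring⟩)
  have h1 := cubicConst_three_mul hq0 hq r
  -- Factor number `r` of `(q; q⁶)_{4r+1}` is `1 - qⁿ`, which survives; the factors after it cancel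
  -- a denominator, those before it are absorbed by `h1`.
  have h2 := qPochhammer_add q (q ^ 6) (r + 1) (3 * r)
  have h3 := qPochhammer_add (q ^ 5 / q ^ (2 * (3 * r))) (q ^ 6) r (2 * r)
  rw [show q * (q ^ 6) ^ (r + 1) = q ^ (2 * (3 * r) + 7) by ring, qPochhammer_succ,
    show q * (q ^ 6) ^ r = q ^ (6 * r + 1) by ring] at h2
  rw [show q ^ 5 / q ^ (2 * (3 * r)) * (q ^ 6) ^ r = q ^ 5 by
    rw [show (q ^ 6) ^ r = q ^ (2 * (3 * r)) by ring]; field_simp,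
    show r + 2 * r = 3 * r by ring] at h3
  have n1 := qPochhammer_pow_ne_zero hq (show 0 < 2 * (3 * r) + 7 by omega) 6 (3 * r)
  have n2 := qPochhammer_pow_ne_zero hq (show 0 < 5 by omega) 6 (2 * r)
  have n3 := qPochhammer_odd_ne_zero hq0 hq (3 * r) r
  rw [h2, h3] at h
  refine mul_left_cancel₀ (mul_ne_zero (mul_ne_zero n1 n2) n3) ?_
  linear_combination q ^ (3 * r) * h + (1 - q ^ (6 * r + 1)) *
    qPochhammer (q ^ (2 * (3 * r) + 7)) (q ^ 6) (3 * r) * qPochhammer (q ^ 5) (q ^ 6) (2 * r) * h1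

theorem sum_cubicTerm_three_mul_add_two {q : K} (hq0 : q ≠ 0)
    (hq : ∀ m : ℕ, 0 < m → q ^ m ≠ 1) (r : ℕ) :
    q ^ (3 * r + 2) * ∑ k ∈ Finset.range (3 * r + 2 + 1),
        cubicTerm (q ^ 2) q ((q ^ 2) ^ (3 * r + 2))⁻¹ k =
      -(1 - q ^ (6 * r + 5)) := by
  have h := mul_sum_cubicTerm_eq hq0 hq (3 * r + 2) (2 * r + 2) (r + 1 + (3 * r + 2))
    (Or.inr ⟨by ring, by ring⟩)
  have h1 := cubicConst_three_mul_add_two hq0 hq r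
  have h2 := qPochhammer_add (q ^ 5) (q ^ 6) (r + 1) (3 * r + 2)
  have h3 := qPochhammer_add (q ^ 5 / q ^ (2 * (3 * r + 2))) (q ^ 6) r (2 * r + 2)
  rw [show q ^ 5 * (q ^ 6) ^ (r + 1) = q ^ (2 * (3 * r + 2) + 7) by ring, qPochhammer_succ,
    show q ^ 5 * (q ^ 6) ^ r = q ^ (6 * r + 5) by ring] at h2
  rw [show q ^ 5 / q ^ (2 * (3 * r + 2)) * (q ^ 6) ^ r = q by
    rw [show q ^ (2 * (3 * r + 2)) = (q ^ 6) ^ r * q ^ 4 by ring]; field_simp,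
    show r + (2 * r + 2) = 3 * r + 2 by ring] at h3
  have n1 := qPochhammer_pow_ne_zero hq (show 0 < 2 * (3 * r + 2) + 7 by omega) 6 (3 * r + 2)
  have n2 := qPochhammer_pow_ne_zero hq (show 0 < 1 by omega) 6 (2 * r + 2)
  rw [pow_one] at n2
  have n3 := qPochhammer_odd_ne_zero hq0 hq (3 * r + 2) r
  rw [h2, h3] at h
  refine mul_left_cancel₀ (mul_ne_zero (mul_ne_zero n1 n2) n3) ?_
  linear_combination q ^ (3 * r + 2) * h + (1 - q ^ (6 * r + 5)) *
    qPochhammer (q ^ (2 * (3 * r + 2) + 7)) (q ^ 6) (3 * r + 2) *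
    qPochhammer q (q ^ 6) (2 * r + 2) * h1

end Evaluation

/-! ### Specialization to the original summand -/

section Summand

variable {K : Type*} [Field K]

theorem cubicSummand_eq_cubicTerm_div {q : K} (hq0 : q ≠ 0) (m k : ℕ) :
    cubicSummand q (2 * m + 1) k = cubicTerm (q ^ 2) q ((q ^ 2) ^ m)⁻¹ k / (1 - q) := by
  have e1 : q ^ (1 - ((2 * m + 1 : ℕ) : ℤ)) = ((q ^ 2) ^ m)⁻¹ := by
    rw [← pow_mul, ← zpow_natCast, ← zpow_neg]; congr 1; push_cast; ring
  have e2 : q ^ (1 + ((2 * m + 1 : ℕ) : ℤ)) = q ^ 2 / ((q ^ 2) ^ m)⁻¹ := by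
    rw [div_inv_eq_mul, ← pow_mul, ← pow_add, ← zpow_natCast]; congr 1; push_cast; ring
  have e3 : q ^ (6 - ((2 * m + 1 : ℕ) : ℤ)) = q * ((q ^ 2) ^ m)⁻¹ * (q ^ 2) ^ 2 := by
    rw [show 6 - ((2 * m + 1 : ℕ) : ℤ) = 5 - (2 * m : ℕ) by push_cast; ring, zpow_sub₀ hq0,
      zpow_natCast, pow_mul, div_eq_mul_inv]
    norm_cast
    ring
  have e4 : q ^ (6 + ((2 * m + 1 : ℕ) : ℤ)) = q * (q ^ 2) ^ 3 / ((q ^ 2) ^ m)⁻¹ := by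
    rw [div_inv_eq_mul]; norm_cast; ring
  have e5 : q ^ (8 * k + 1) = q * (q ^ 2) ^ (4 * k) := by ring
  rw [cubicSummand, cubicTerm, qNumber, e1, e2, e3, e4, e5, show q ^ 6 = (q ^ 2) ^ 3 by ring,
    pow_mul q 2 (k ^ 2)]
  ring

theorem cubicSummand_eq_zero {q : K} (hq0 : q ≠ 0) {m k : ℕ} (hk : m < k) :
    cubicSummand q (2 * m + 1) k = 0 := by
  rw [cubicSummand_eq_cubicTerm_div hq0,
    cubicTerm_eq_zero (inv_mul_cancel₀ (pow_ne_zero m (pow_ne_zero 2 hq0))) hk, zero_div]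

theorem sum_cubicSummand {q : K} (hq0 : q ≠ 0) (m : ℕ) :
    ∑ k ∈ Finset.range (2 * m + 1), cubicSummand q (2 * m + 1) k =
      (∑ k ∈ Finset.range (m + 1), cubicTerm (q ^ 2) q ((q ^ 2) ^ m)⁻¹ k) / (1 - q) := by
  rw [Finset.sum_div, Finset.sum_congr rfl fun k _ => (cubicSummand_eq_cubicTerm_div hq0 m k)]
  refine (Finset.sum_subset (Finset.range_mono (by omega)) fun k _ hk => ?_).symm
  rw [← cubicSummand_eq_cubicTerm_div hq0]
  exact cubicSummand_eq_zero hq0 (by simpa using hk)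

end Summand

theorem mainTheorem6 {K : Type*} [Field K] (q : K) (hq0 : q ≠ 0)
    (hq : ∀ m : ℕ, 0 < m → q ^ m ≠ 1) (n : ℕ) (hn : Odd n) :
    (∀ k : ℕ, (n - 1) / 2 < k → cubicSummand q n k = 0) ∧
    ∑ k ∈ Finset.range n, cubicSummand q n k =
      q ^ (-(((n : ℤ) - 1) / 2)) * qNumber q n * ((jacobiSym (-3) n : ℤ) : K) := by
  obtain ⟨m, rfl⟩ := hn
  refine ⟨fun k hk => cubicSummand_eq_zero hq0 (by omega), ?_⟩
  have hz : q ^ (-((((2 * m + 1 : ℕ) : ℤ) - 1) / 2)) = (q ^ m)⁻¹ := by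
    rw [zpow_neg, ← zpow_natCast]; congr 2; omega
  have hq1 : 1 - q ≠ 0 := sub_ne_zero.2 (by simpa using (hq 1 one_pos).symm)
  have hm0 : q ^ m ≠ 0 := pow_ne_zero m hq0
  -- The symbol depends only on `n` mod 12, so each class of `m` mod 3 leaves two residues to
  -- evaluate.
  rw [sum_cubicSummand hq0, hz, qNumber, jacobiSym.mod_right (-3) ⟨m, rfl⟩]
  have hr : m = 3 * (m / 3) ∨ m = 3 * (m / 3) + 1 ∨ m = 3 * (m / 3) + 2 := by omega
  generalize m / 3 = r at hr
  rcases hr with rfl | rfl | rfl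
  · have h := sum_cubicTerm_three_mul hq0 hq r
    have hJ : jacobiSym (-3) ((2 * (3 * r) + 1) % (4 * (-3 : ℤ).natAbs)) = 1 := by
      have : (2 * (3 * r) + 1) % (4 * (-3 : ℤ).natAbs) = 1 ∨
          (2 * (3 * r) + 1) % (4 * (-3 : ℤ).natAbs) = 7 := by
        rw [show (4 * (-3 : ℤ).natAbs) = 12 from rfl]; omega
      rcases this with h | h <;> rw [h] <;> norm_num
    rw [hJ, show 2 * (3 * r) + 1 = 6 * r + 1 by ring, ← h]
    field_simp
    simp
  · have hJ : jacobiSym (-3) ((2 * (3 * r + 1) + 1) % (4 * (-3 : ℤ).natAbs)) = 0 := by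
      have : (2 * (3 * r + 1) + 1) % (4 * (-3 : ℤ).natAbs) = 3 ∨
          (2 * (3 * r + 1) + 1) % (4 * (-3 : ℤ).natAbs) = 9 := by
        rw [show (4 * (-3 : ℤ).natAbs) = 12 from rfl]; omega
      rcases this with h | h <;> rw [h] <;> norm_num
    rw [hJ, sum_cubicTerm_three_mul_add_one hq0 hq]
    simp
  · have h := sum_cubicTerm_three_mul_add_two hq0 hq r
    have hJ : jacobiSym (-3) ((2 * (3 * r + 2) + 1) % (4 * (-3 : ℤ).natAbs)) = -1 := by
      have : (2 * (3 * r + 2) + 1) % (4 * (-3 : ℤ).natAbs) = 5 ∨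
          (2 * (3 * r + 2) + 1) % (4 * (-3 : ℤ).natAbs) = 11 := by
        rw [show (4 * (-3 : ℤ).natAbs) = 12 from rfl]; omega
      rcases this with h | h <;> rw [h] <;> norm_num
    rw [hJ, show 2 * (3 * r + 2) + 1 = 6 * r + 5 by ring,
      ← neg_neg (1 - q ^ (6 * r + 5)), ← h]
    field_simp
    simp
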